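/- Let $M$ be a (Hausdorff, finite-dimensional) $C^\infty$ manifold, let $n, h$ be integers with $0\le 2h\le n-3$, and let $P\in\Gamma(\wedge^n TM)$ be a smooth $n$-vector field. Suppose that every point $x\in M$ has an open neighbourhood $U_x$ carrying smooth vector fields $V_1,\dots,V_n,W_1,\dots,W_n$ such that on $U_x$ $$P=\frac{1}{h!\,(n-h)!}\sum_{\sigma\in S_n}(\operatorname{sign}\sigma)\,V_{\sigma_1}\wedge\dots\wedge V_{\sigma_h}\wedge W_{\sigma_{h+1}}\wedge\dots\wedge W_{\sigma_n},\qquad (7)$$ where, at each point of $U_x$, the $2n$ vectors $V_1,\dots,V_n,W_1,\dots,W_n$ are linearly independent if $h\neq 0$, and the $n$ vectors $W_1,\dots,W_n$ are linearly independent if $h=0$ (when no $V_i$ occurs in (7)). Then: (1) $P$ is a Poisson $n$-vector field: the bracket $\{f_1,\dots,f_n\}=P(df_1,\dots,df_n)$ satisfies $$\sum_{\sigma\in S_{2n-1}}(\operatorname{sign}\sigma)\,\{\{f_{\sigma_1},\dots,f_{\sigma_n}\},f_{\sigma_{n+1}},\dots,f_{\sigma_{2n-1}}\}=0$$ for all $f_1,\dots,f_{2n-1}\in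 C^\infty(M)$. (2) $P$ has constant rank, where the rank of $P$ at $x$ is the dimension of the image of the map $\sharp_P:\wedge^{n-1}T_x^*M\to T_xM$, $\lambda\mapsto i(\lambda)P$. The rank is $2n$ at every point if $h\neq 0$, and $n$ at every point if $h=0$. (3) If $h=0$, then $P$ is decomposable: every point has an open neighbourhood on which $P=W_1\wedge\dots\wedge W_n$ for some smooth vector fields $W_1,\dots,W_n$. -/

import Mathlib

open scoped Manifold ContDiff

namespace NPoisson

noncomputable section

/-! ### Linear algebra of `n`-vectors -/

section LinearAlgebra

variable {L : Type*} [AddCommGroup L] [Module ℝ L]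

/-- The interior product `i(λ) : ⋀ L → ⋀ L` for `λ ∈ ⋀ L*`.  For a covector it is the usual
antiderivation (contraction), and `i(λ ∧ μ) = i(λ) ∘ i(μ)`. -/
def interiorProduct : ExteriorAlgebra ℝ (Module.Dual ℝ L) →ₐ[ℝ] Module.End ℝ (ExteriorAlgebra ℝ L) :=
  ExteriorAlgebra.lift ℝ
    ⟨CliffordAlgebra.contractLeft (Q := (0 : QuadraticForm ℝ L)), fun d => by
      refine LinearMap.ext fun x => ?_
      exact CliffordAlgebra.contractLeft_contractLeft (Q := (0 : QuadraticForm ℝ L)) d x⟩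

/-- The map `♯_P : ⋀ⁿ⁻¹ L* → L`, `♯_P(λ) = i(λ) P`, of an `n`-vector `P`.  The element `i(λ) P` of
`⋀ L` has degree one, and `ExteriorAlgebra.ιInv` reads it as a vector of `L`. -/
def sharp {n : ℕ} (P : ⋀[ℝ]^n L) : ⋀[ℝ]^(n - 1) (Module.Dual ℝ L) →ₗ[ℝ] L :=
  ExteriorAlgebra.ιInv ∘ₗ LinearMap.applyₗ (P : ExteriorAlgebra ℝ L) ∘ₗ
    interiorProduct.toLinearMap ∘ₗ (⋀[ℝ]^(n - 1) (Module.Dual ℝ L)).subtype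

/-- The rank of an `n`-vector `P`: the dimension of the image of `♯_P`. -/
def rank {n : ℕ} (P : ⋀[ℝ]^n L) : ℕ := Module.finrank ℝ (LinearMap.range (sharp P))

/-- The value `P(α₁, …, αₙ)` of an `n`-vector on covectors, so that
`(v₁ ∧ … ∧ vₙ)(α₁, …, αₙ) = det (αⱼ(vᵢ))`. -/
def eval {n : ℕ} (P : ⋀[ℝ]^n L) (α : Fin n → Module.Dual ℝ L) : ℝ :=
  exteriorPower.pairingDual ℝ L n (exteriorPower.ιMulti ℝ n α) P

/-- The `n`-vector
`1 / (h! (n-h)!) ∑_σ sign(σ) v_{σ 1} ∧ … ∧ v_{σ h} ∧ w_{σ (h+1)} ∧ … ∧ w_{σ n}`. -/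
def alternatingWedge {n : ℕ} (h : ℕ) (v w : Fin n → L) : ⋀[ℝ]^n L :=
  (1 / ((h.factorial : ℝ) * ((n - h).factorial : ℝ))) •
    ∑ σ : Equiv.Perm (Fin n), ((Equiv.Perm.sign σ : ℤ) : ℝ) •
      exteriorPower.ιMulti ℝ n (fun i : Fin n => if (i : ℕ) < h then v (σ i) else w (σ i))

end LinearAlgebra

/-! ### `n`-vector fields and `n`-ary Poisson brackets -/

section Manifold

variable {E : Type*} [NormedAddCommGroup E] [NormedSpace ℝ E]
  {M : Type*} [TopologicalSpace M] [ChartedSpace E M] [IsManifold 𝓘(ℝ, E) ∞ M]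

/-- The function `{f₁, …, fₙ} = P(df₁, …, dfₙ)`, for a field `P` of `n`-vectors. -/
def bracket {n : ℕ} (P : (x : M) → ⋀[ℝ]^n (TangentSpace 𝓘(ℝ, E) x)) (f : Fin n → M → ℝ) :
    M → ℝ :=
  fun x => eval (P x) fun i =>
    (mvfderiv 𝓘(ℝ, E) (f i) x : TangentSpace 𝓘(ℝ, E) x →L[ℝ] ℝ).toLinearMap

variable (E M) in
/-- Smooth `n`-vector fields, i.e. smooth sections of `⋀ⁿ TM`.  Smoothness is smoothness of the
components `P(dx^{a₁}, …, dx^{aₙ})` in local coordinates; here the coordinate functions are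
`ξ ∘ φ` for the charts `φ` of `M` and the linear forms `ξ` on the model space. -/
structure MultivectorField (n : ℕ) where
  /-- the `n`-vector at a point -/
  toFun : (x : M) → ⋀[ℝ]^n (TangentSpace 𝓘(ℝ, E) x)
  /-- the components in local coordinates are smooth -/
  smooth : ∀ (x₀ : M) (ξ : Fin n → (E →L[ℝ] ℝ)),
    ContMDiffOn 𝓘(ℝ, E) 𝓘(ℝ, ℝ) ∞ (bracket toFun fun i y => ξ i (chartAt E x₀ y))
      (chartAt E x₀).source

/-- `P` is a Poisson `n`-vector field: the bracket `{f₁, …, fₙ} = P(df₁, …, dfₙ)` of smooth functions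
satisfies the generalized Jacobi identity
`∑_{σ ∈ S_{2n-1}} sign(σ) {{f_{σ 1}, …, f_{σ n}}, f_{σ (n+1)}, …, f_{σ (2n-1)}} = 0`. -/
def IsPoisson {n : ℕ} (P : MultivectorField E M n) : Prop :=
  ∀ (f : Fin (2 * n - 1) → M → ℝ), (∀ i, ContMDiff 𝓘(ℝ, E) 𝓘(ℝ, ℝ) ∞ (f i)) →
    ∀ x : M, ∑ σ : Equiv.Perm (Fin (2 * n - 1)), ((Equiv.Perm.sign σ : ℤ) : ℝ) *
      bracket P.toFun (fun i : Fin n =>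
        if (i : ℕ) = 0 then
          bracket P.toFun (fun j : Fin n => f (σ ⟨j, by have := j.isLt; omega⟩))
        else f (σ ⟨n + i - 1, by have := i.isLt; omega⟩)) x = 0

/-- `X` restricts to a smooth vector field on the open set `U`. -/
def IsSmoothVectorFieldOn (X : (y : M) → TangentSpace 𝓘(ℝ, E) y) (U : Set M) : Prop :=
  ContMDiffOn 𝓘(ℝ, E) 𝓘(ℝ, E).tangent ∞ (fun y => (⟨y, X y⟩ : TangentBundle 𝓘(ℝ, E) M)) U

/-- Around every point there are an open set `U` and smooth vector fields `Vᵢ`, `Wⱼ`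
(`i, j = 1, …, n`) on `U` such that `P` is on `U` the alternating sum of wedges of `h` of the `Vᵢ`
and `n - h` of the `Wⱼ`, and the fields which occur in this expression are independent at each point
of `U`: all the `Wⱼ` and, if `h ≠ 0`, the `Vᵢ` together with the `Wⱼ`. -/
def HasSemiDecomposableForm {n : ℕ} (P : MultivectorField E M n) (h : ℕ) : Prop :=
  ∀ x : M, ∃ U : Set M, IsOpen U ∧ x ∈ U ∧
    ∃ V W : Fin n → (y : M) → TangentSpace 𝓘(ℝ, E) y,
      (∀ i, IsSmoothVectorFieldOn (V i) U) ∧ (∀ j, IsSmoothVectorFieldOn (W j) U) ∧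
      (∀ y ∈ U, LinearIndependent ℝ (fun j => W j y)) ∧
      (h ≠ 0 → ∀ y ∈ U, LinearIndependent ℝ (Sum.elim (fun i => V i y) (fun j => W j y))) ∧
      ∀ y ∈ U, P.toFun y = alternatingWedge h (fun i => V i y) (fun j => W j y)

/-- `P` is decomposable: around every point, `P = W₁ ∧ … ∧ Wₙ` for smooth vector fields `Wⱼ`. -/
def IsDecomposable {n : ℕ} (P : MultivectorField E M n) : Prop :=
  ∀ x : M, ∃ U : Set M, IsOpen U ∧ x ∈ U ∧
    ∃ W : Fin n → (y : M) → TangentSpace 𝓘(ℝ, E) y,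
      (∀ j, IsSmoothVectorFieldOn (W j) U) ∧
      ∀ y ∈ U, P.toFun y = exteriorPower.ιMulti ℝ n (fun j => W j y)

end Manifold

end

end NPoisson

namespace NPoisson

/-! ### Contraction, evaluation and rank of `n`-vectors. -/

section LinearAlgebra

variable {L : Type*} [AddCommGroup L] [Module ℝ L]

/-! Jacobi: on `U`, `P` is a finite sum of products of the `Vᵢ` and `Wⱼ`. By Leibniz the iterated
bracket is a sum of products of `2n - 1` factors, exactly one of them a second-order operator. For
each choice of fields, the signed sum over `σ` is a determinant whose rows are these operators. Each
of the two terms of `P` involved contains `n - h` of the `Wⱼ`; dropping from each the slot used by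
the second-order row leaves at least `n - h - 1`, and `2(n - h - 1) > n`, so some `Wⱼ` gives two
equal rows (`exists_common_index`, `sum_bracket_bracket_eq_zero`). No commutation of the fields is
needed.

Rank: by `dual_sharp`, a covector `β` kills the image of `♯_P` iff `P(α, β) = 0` for all `α`.
Evaluation on a dual family with one member replaced by `β` shows that this means `β` kills every
field occurring in `P`, so the image is their span. -/

theorem contractLeft_ιMulti_succ (d : Module.Dual ℝ L) {n : ℕ} (v : Fin (n + 1) → L) :
    CliffordAlgebra.contractLeft (Q := (0 : QuadraticForm ℝ L)) d (ExteriorAlgebra.ιMulti ℝ (n + 1) v) =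
      ∑ i : Fin (n + 1), ((-1 : ℝ) ^ (i : ℕ) * d (v i)) •
        ExteriorAlgebra.ιMulti ℝ n (fun j => v (i.succAbove j)) := by
  induction n with
  | zero =>
    rw [ExteriorAlgebra.ιMulti_succ_apply]
    simp only [ExteriorAlgebra.ιMulti_zero_apply, mul_one]
    refine (CliffordAlgebra.contractLeft_ι (Q := (0 : QuadraticForm ℝ L)) d (v 0)).trans ?_
    simp [Algebra.algebraMap_eq_smul_one]
  | succ n ih =>
    rw [ExteriorAlgebra.ιMulti_succ_apply]
    refine (CliffordAlgebra.contractLeft_ι_mul (Q := (0 : QuadraticForm ℝ L)) d (v 0)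
      (ExteriorAlgebra.ιMulti ℝ (n + 1) (Matrix.vecTail v))).trans ?_
    rw [ih, Fin.sum_univ_succ (n := n + 1), sub_eq_add_neg]
    congr 1
    · simp only [Fin.val_zero, pow_zero, one_mul, Fin.succAbove_zero]
      rfl
    · rw [Finset.mul_sum, ← Finset.sum_neg_distrib]
      refine Finset.sum_congr rfl fun i _ => ?_
      rw [ExteriorAlgebra.ιMulti_succ_apply (v := fun j => v (i.succ.succAbove j))]
      rw [mul_smul_comm, ← neg_smul]
      have htail : (Matrix.vecTail fun j => v (i.succ.succAbove j)) =
          fun j => Matrix.vecTail v (i.succAbove j) := by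
        ext j : 1
        simp [Matrix.vecTail]
      rw [htail, Fin.succ_succAbove_zero]
      congr 1
      simp [Matrix.vecTail, pow_succ]

/-- The iterated contraction of a decomposable multivector with covectors, paired with one more
covector, is a determinant. -/
theorem dual_ιInv_interiorProduct_ιMulti {m : ℕ} (α : Fin m → Module.Dual ℝ L)
    (β : Module.Dual ℝ L) (v : Fin (m + 1) → L) :
    β (ExteriorAlgebra.ιInv (interiorProduct
      (ExteriorAlgebra.ιMulti ℝ m (fun i => α i.rev)) (ExteriorAlgebra.ιMulti ℝ (m + 1) v))) =
    Matrix.det (Matrix.of fun i j => (Fin.snoc α β : Fin (m + 1) → Module.Dual ℝ L) j (v i)) := by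
  induction m with
  | zero =>
    simp [ExteriorAlgebra.ιMulti_succ_apply, ExteriorAlgebra.ι_leftInverse _, Fin.snoc]
  | succ m ih =>
    -- Since `i(λ ∧ μ) = i(λ) ∘ i(μ)`, the last factor contracts first. The reversal makes this `α
    -- 0`, matching the expansion along column zero.
    have hα : ExteriorAlgebra.ιMulti ℝ (m + 1) (fun i => α i.rev) =
        ExteriorAlgebra.ιMulti ℝ m (fun i => α i.rev.succ) * ExteriorAlgebra.ι ℝ (α 0) := by
      rw [ExteriorAlgebra.ιMulti_apply, ExteriorAlgebra.ιMulti_apply, List.ofFn_succ',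
        List.concat_eq_append, List.prod_append, List.prod_singleton]
      simp [Fin.rev_castSucc]
    have hι : interiorProduct (ExteriorAlgebra.ι ℝ (α 0)) =
        CliffordAlgebra.contractLeft (Q := (0 : QuadraticForm ℝ L)) (α 0) := by
      simp [interiorProduct]
    rw [hα, map_mul, Module.End.mul_apply, hι, contractLeft_ιMulti_succ, Matrix.det_succ_column_zero]
    simp only [map_sum, map_smul, smul_eq_mul]
    refine Finset.sum_congr rfl fun i _ => ?_
    rw [ih (fun i => α i.succ)]
    congr 2
    ext a b
    simp only [Matrix.of_apply, Matrix.submatrix_apply]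
    congr 1
    refine Fin.lastCases ?_ (fun b => ?_) b
    · rw [Fin.succ_last, Fin.snoc_last, Fin.snoc_last]
    · rw [Fin.succ_castSucc, Fin.snoc_castSucc, Fin.snoc_castSucc]

theorem eval_ιMulti {n : ℕ} (v : Fin n → L) (α : Fin n → Module.Dual ℝ L) :
    eval (exteriorPower.ιMulti ℝ n v) α = Matrix.det (Matrix.of fun i j => α j (v i)) := by
  simp [eval]

/-- Both sides are linear in `P`, so decomposable `P` suffice. -/
theorem dual_sharp {m : ℕ} (P : ⋀[ℝ]^(m + 1) L) (α : Fin m → Module.Dual ℝ L)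
    (β : Module.Dual ℝ L) :
    β (sharp P (exteriorPower.ιMulti ℝ m (fun i => α i.rev))) =
      eval P (Fin.snoc α β : Fin (m + 1) → Module.Dual ℝ L) := by
  let F : ⋀[ℝ]^(m + 1) L →ₗ[ℝ] ℝ := β ∘ₗ ExteriorAlgebra.ιInv ∘ₗ
    (interiorProduct (ExteriorAlgebra.ιMulti ℝ m (fun i => α i.rev))) ∘ₗ
      (⋀[ℝ]^(m + 1) L).subtype
  have : F = exteriorPower.pairingDual ℝ L (m + 1)
      (exteriorPower.ιMulti ℝ (m + 1) (Fin.snoc α β : Fin (m + 1) → Module.Dual ℝ L)) := by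
    refine exteriorPower.linearMap_ext (AlternatingMap.ext fun v => ?_)
    exact (dual_ιInv_interiorProduct_ιMulti α β v).trans (eval_ιMulti v _).symm
  exact LinearMap.congr_fun this P

/-- The covectors which vanish on the image of `♯_P`. -/
theorem dual_sharp_eq_zero_iff {m : ℕ} (P : ⋀[ℝ]^(m + 1) L) (β : Module.Dual ℝ L) :
    (∀ x ∈ LinearMap.range (sharp P), β x = 0) ↔
      ∀ α : Fin m → Module.Dual ℝ L,
        eval P (Fin.snoc α β : Fin (m + 1) → Module.Dual ℝ L) = 0 := by
  constructor
  · intro H α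
    rw [← dual_sharp]
    exact H _ ⟨_, rfl⟩
  · rintro H _ ⟨l, rfl⟩
    have : β ∘ₗ sharp P = 0 := by
      refine exteriorPower.linearMap_ext (AlternatingMap.ext fun α => ?_)
      have := dual_sharp P (fun i => α i.rev) β
      simp only [Fin.rev_rev] at this
      exact this.trans (H _)
    exact LinearMap.congr_fun this l

/-- A subspace is determined by its annihilator, in any dimension. -/
theorem range_sharp_eq_span {ι : Type*} {m : ℕ} (P : ⋀[ℝ]^(m + 1) L) (u : ι → L)
    (H : ∀ β : Module.Dual ℝ L, (∀ α : Fin m → Module.Dual ℝ L,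
      eval P (Fin.snoc α β : Fin (m + 1) → Module.Dual ℝ L) = 0) ↔ ∀ i, β (u i) = 0) :
    LinearMap.range (sharp P) = Submodule.span ℝ (Set.range u) := by
  apply Subspace.dualAnnihilator_inj.1
  ext β
  rw [Submodule.mem_dualAnnihilator, Submodule.mem_dualAnnihilator, dual_sharp_eq_zero_iff, H]
  constructor
  · intro h w hw
    induction hw using Submodule.span_induction with
    | mem x hx => obtain ⟨i, rfl⟩ := hx; exact h i
    | zero => simp
    | add x y _ _ hx hy => simp [hx, hy]
    | smul a x _ hx => simp [hx]
  · exact fun h i => h _ (Submodule.subset_span ⟨i, rfl⟩)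

theorem rank_eq_card {ι : Type*} [Fintype ι] {m : ℕ} (P : ⋀[ℝ]^(m + 1) L) (u : ι → L)
    (hu : LinearIndependent ℝ u)
    (H : ∀ β : Module.Dual ℝ L, (∀ α : Fin m → Module.Dual ℝ L,
      eval P (Fin.snoc α β : Fin (m + 1) → Module.Dual ℝ L) = 0) ↔ ∀ i, β (u i) = 0) :
    rank P = Fintype.card ι := by
  rw [rank, range_sharp_eq_span P u H, finrank_span_eq_card hu]

/-- Vanishing of `P(α, β)` for all `α` does not depend on the position of `β`. -/
theorem eval_eq_zero_of_eval_snoc {m : ℕ} (P : ⋀[ℝ]^(m + 1) L) (β : Module.Dual ℝ L)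
    (H : ∀ α : Fin m → Module.Dual ℝ L, eval P (Fin.snoc α β : Fin (m + 1) → Module.Dual ℝ L) = 0)
    (γ : Fin (m + 1) → Module.Dual ℝ L) (k : Fin (m + 1)) (hk : γ k = β) : eval P γ = 0 := by
  have h1 : eval P (γ ∘ Equiv.swap k (Fin.last m)) = 0 := by
    have : γ ∘ Equiv.swap k (Fin.last m) =
        (Fin.snoc (fun i => γ (Equiv.swap k (Fin.last m) i.castSucc)) β :
          Fin (m + 1) → Module.Dual ℝ L) := by
      ext i : 1
      refine Fin.lastCases ?_ (fun i => ?_) i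
      · simp [hk]
      · simp
    rw [this]
    exact H _
  unfold eval at h1 ⊢
  rw [AlternatingMap.map_perm] at h1
  rcases Int.units_eq_one_or (Equiv.Perm.sign (Equiv.swap k (Fin.last m))) with h | h <;>
    simpa [h] using h1

/-- Here `ρ` comes from the definition of the wedge sum and `τ` from the Leibniz formula for each
determinant. -/
theorem eval_alternatingWedge {n : ℕ} (h : ℕ) (v w : Fin n → L) (α : Fin n → Module.Dual ℝ L) :
    eval (alternatingWedge h v w) α =
      (1 / ((h.factorial : ℝ) * ((n - h).factorial : ℝ))) *
        ∑ ρ : Equiv.Perm (Fin n), ∑ τ : Equiv.Perm (Fin n),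
          ((Equiv.Perm.sign ρ : ℤ) : ℝ) * ((Equiv.Perm.sign τ : ℤ) : ℝ) *
            ∏ i, α i (if (τ i : ℕ) < h then v (ρ (τ i)) else w (ρ (τ i))) := by
  have : ∀ z : Fin n → L, exteriorPower.pairingDual ℝ L n (exteriorPower.ιMulti ℝ n α)
      (exteriorPower.ιMulti ℝ n z) =
      ∑ τ : Equiv.Perm (Fin n), ((Equiv.Perm.sign τ : ℤ) : ℝ) * ∏ i, α i (z (τ i)) := by
    intro z
    rw [exteriorPower.pairingDual_ιMulti_ιMulti, Matrix.det_apply']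
    rfl
  simp only [eval, alternatingWedge, map_smul, map_sum, this, smul_eq_mul, Finset.mul_sum,
    mul_assoc]

theorem alternatingWedge_zero {n : ℕ} (v w : Fin n → L) :
    alternatingWedge 0 v w = exteriorPower.ιMulti ℝ n w := by
  have : ∀ σ : Equiv.Perm (Fin n), ((Equiv.Perm.sign σ : ℤ) : ℝ) •
      exteriorPower.ιMulti ℝ n (fun i : Fin n => w (σ i)) = exteriorPower.ιMulti ℝ n w := by
    intro σ
    have h := AlternatingMap.map_perm (exteriorPower.ιMulti ℝ n) w σ
    have h' : (fun i : Fin n => w (σ i)) = w ∘ σ := rfl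
    rw [h', h]
    rcases Int.units_eq_one_or (Equiv.Perm.sign σ) with hs | hs <;> simp [hs]
  simp only [alternatingWedge, Nat.not_lt_zero, if_false, this]
  rw [Finset.sum_const, Finset.card_univ, Fintype.card_perm, Fintype.card_fin,
    ← Nat.cast_smul_eq_nsmul ℝ, smul_smul]
  have := Nat.factorial_ne_zero n
  simp [this]

theorem eval_alternatingWedge_comp_perm {n : ℕ} (h : ℕ) (v w : Fin n → L)
    (π : Equiv.Perm (Fin n)) (α : Fin n → Module.Dual ℝ L) :
    eval (alternatingWedge h (v ∘ π) (w ∘ π)) α =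
      ((Equiv.Perm.sign π : ℤ) : ℝ) * eval (alternatingWedge h v w) α := by
  simp only [eval_alternatingWedge]
  rw [mul_left_comm]
  congr 1
  rw [Finset.mul_sum]
  symm
  rw [← Equiv.sum_comp (Equiv.mulLeft π)]
  refine Finset.sum_congr rfl fun ρ _ => ?_
  rw [Finset.mul_sum]
  refine Finset.sum_congr rfl fun τ _ => ?_
  rcases Int.units_eq_one_or (Equiv.Perm.sign π) with hs | hs <;> simp [hs]

/-- Evaluation of `alternatingWedge h v w` on the covectors dual to `v 0, …, v (h-1), w h, …`, with
the `k`-th one replaced by an arbitrary covector. -/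
theorem exists_eval_alternatingWedge_eq {n : ℕ} (h : ℕ) (v w : Fin n → L)
    (γ : Fin n → Module.Dual ℝ L) (k : Fin n)
    (hγ : ∀ i j l : Fin n, j ≠ k → γ j (if (i : ℕ) < h then v l else w l) =
      if l = j ∧ ((i : ℕ) < h ↔ (j : ℕ) < h) then 1 else 0) :
    ∃ c : ℝ, c ≠ 0 ∧ eval (alternatingWedge h v w) γ =
      c * γ k (if (k : ℕ) < h then v k else w k) := by
  classical
  have key : ∀ ρ τ : Equiv.Perm (Fin n), ((Equiv.Perm.sign ρ : ℤ) : ℝ) *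
      ((Equiv.Perm.sign τ : ℤ) : ℝ) *
        ∏ i, γ i (if (τ i : ℕ) < h then v (ρ (τ i)) else w (ρ (τ i))) =
      if ρ = τ⁻¹ ∧ ∀ i, (τ i : ℕ) < h ↔ (i : ℕ) < h then
        γ k (if (k : ℕ) < h then v k else w k) else 0 := by
    intro ρ τ
    by_cases hc : ρ = τ⁻¹ ∧ ∀ i, (τ i : ℕ) < h ↔ (i : ℕ) < h
    · rw [if_pos hc]
      obtain ⟨rfl, hc⟩ := hc
      rw [← Finset.mul_prod_erase _ _ (Finset.mem_univ k), Finset.prod_eq_one]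
      · rcases Int.units_eq_one_or (Equiv.Perm.sign τ) with hs | hs <;> simp [hs, hc]
      · intro j hj
        rw [hγ _ _ _ (Finset.ne_of_mem_erase hj), if_pos]
        exact ⟨by simp, hc j⟩
    · rw [if_neg hc]
      by_contra hne
      have hprod := right_ne_zero_of_mul hne
      rw [Finset.prod_ne_zero_iff] at hprod
      have hj : ∀ j, j ≠ k → ρ (τ j) = j ∧ ((τ j : ℕ) < h ↔ (j : ℕ) < h) := by
        intro j hj
        have := hprod j (Finset.mem_univ j)
        rw [hγ _ _ _ hj] at this
        by_contra h'
        exact this (if_neg h')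
      -- A permutation fixing every index except possibly `k` fixes `k` too.
      have hk : ρ (τ k) = k := by
        by_contra hk
        have := (hj _ hk).1
        exact hk ((ρ * τ).injective this)
      have hρτ : ρ = τ⁻¹ := by
        rw [eq_inv_iff_mul_eq_one]
        ext j : 1
        by_cases hjk : j = k
        · subst hjk; exact hk
        · exact (hj j hjk).1
      refine hc ⟨hρτ, fun j => ?_⟩
      by_cases hjk : j = k
      · subst hjk
        -- The block `{i < h}` and its preimage under `τ` have equal size and agree off `k`, hence
        -- also at `k`.
        have h1 := Fintype.card_congr (τ.subtypeEquiv (p := fun i : Fin n => ((τ i : ℕ) < h))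
          (q := fun i : Fin n => (i : ℕ) < h) (fun i => Iff.rfl))
        rw [Fintype.card_subtype, Fintype.card_subtype] at h1
        by_contra h2
        rw [← Finset.insert_erase (Finset.mem_univ j), Finset.filter_insert,
          Finset.filter_insert] at h1
        have h3 : Finset.filter (fun i : Fin n => (τ i : ℕ) < h) (Finset.univ.erase j) =
            Finset.filter (fun i : Fin n => (i : ℕ) < h) (Finset.univ.erase j) :=
          Finset.filter_congr fun i hi => (hj i (Finset.ne_of_mem_erase hi)).2
        rw [h3] at h1
        by_cases ha : (τ j : ℕ) < h <;> by_cases hb : (j : ℕ) < h <;> simp_all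
      · exact (hj j hjk).2
  let S : Finset (Equiv.Perm (Fin n)) :=
    Finset.univ.filter fun τ => ∀ i, (τ i : ℕ) < h ↔ (i : ℕ) < h
  refine ⟨(1 / ((h.factorial : ℝ) * ((n - h).factorial : ℝ))) * S.card, ?_, ?_⟩
  · have h1 : S.card ≠ 0 := Finset.card_ne_zero_of_mem (a := 1) (by simp [S])
    have := Nat.factorial_ne_zero h
    have := Nat.factorial_ne_zero (n - h)
    positivity
  · rw [eval_alternatingWedge, mul_assoc]
    congr 1
    rw [Finset.sum_comm]
    simp only [key, ite_and]
    simp [S, Finset.sum_ite, ← nsmul_eq_mul]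

theorem exists_dual_of_linearIndependent {ι : Type*} [DecidableEq ι] {u : ι → L}
    (hu : LinearIndependent ℝ u) :
    ∃ f : ι → Module.Dual ℝ L, ∀ i j, f i (u j) = if j = i then 1 else 0 := by
  obtain ⟨g, hg⟩ := LinearMap.exists_leftInverse_of_injective (Finsupp.linearCombination ℝ u)
    (LinearMap.ker_eq_bot.2 hu)
  refine ⟨fun i => Finsupp.lapply i ∘ₗ g, fun i j => ?_⟩
  have h1 := LinearMap.congr_fun hg (Finsupp.single j 1)
  simp only [LinearMap.comp_apply, Finsupp.linearCombination_single, one_smul,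
    LinearMap.id_apply] at h1
  simp [h1, Finsupp.single_apply]

/-- The rank of `alternatingWedge h (u ∘ a) (u ∘ b)` for an independent family `u` all of whose
members occur in it. -/
theorem rank_alternatingWedge {ι : Type*} [Fintype ι] {n h : ℕ} (hn : h < n) {u : ι → L}
    (hu : LinearIndependent ℝ u) (a b : Fin n → ι) (hb : Function.Injective b)
    (ha : h ≠ 0 → Function.Injective a) (hab : h ≠ 0 → ∀ i j, a i ≠ b j)
    (hsurj : ∀ i, (h ≠ 0 ∧ ∃ j, a j = i) ∨ ∃ j, b j = i) :
    rank (alternatingWedge h (u ∘ a) (u ∘ b)) = Fintype.card ι := by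
  classical
  obtain ⟨m, rfl⟩ : ∃ m, n = m + 1 := ⟨n - 1, by omega⟩
  refine rank_eq_card _ u hu fun β => ⟨fun H => ?_, fun H α => ?_⟩
  · obtain ⟨f, hf⟩ := exists_dual_of_linearIndependent hu
    -- Permuting indices only changes the sign of `P`, so any `a j` can be moved to slot `0` (when
    -- `h ≠ 0`) and any `b j` to the last slot (as `h < n`).
    have key : ∀ (π : Equiv.Perm (Fin (m + 1))) (k : Fin (m + 1)),
        β (if (k : ℕ) < h then u (a (π k)) else u (b (π k))) = 0 := by
      intro π k
      let γ : Fin (m + 1) → Module.Dual ℝ L := fun j =>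
        if j = k then β else f (if (j : ℕ) < h then a (π j) else b (π j))
      obtain ⟨c, hc, hcγ⟩ := exists_eval_alternatingWedge_eq h (u ∘ a ∘ π) (u ∘ b ∘ π) γ k (by
        intro i j l hjk
        have hne : ∀ i : Fin (m + 1), (i : ℕ) < h → h ≠ 0 := fun i hi => by omega
        simp only [γ, if_neg hjk, Function.comp_apply]
        by_cases hi : (i : ℕ) < h <;> by_cases hj : (j : ℕ) < h
        · simp [hi, hj, hf, (ha (hne i hi)).eq_iff]
        · simp [hi, hj, hf, hab (hne i hi)]
        · simp [hi, hj, hf, (hab (hne j hj) _ _).symm]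
        · simp [hi, hj, hf, hb.eq_iff])
      have h0 := eval_eq_zero_of_eval_snoc _ β H γ k (by simp [γ])
      have h1 := eval_alternatingWedge_comp_perm h (u ∘ a) (u ∘ b) π γ
      rw [h0, mul_zero, Function.comp_assoc, Function.comp_assoc, hcγ] at h1
      simpa [hc, γ] using h1
    intro i
    rcases hsurj i with ⟨h0, j, rfl⟩ | ⟨j, rfl⟩
    · have := key (Equiv.swap 0 j) 0
      rwa [if_pos (by simp; omega), Equiv.swap_apply_left] at this
    · have := key (Equiv.swap (Fin.last m) j) (Fin.last m)
      rwa [if_neg (by simp; omega), Equiv.swap_apply_left] at this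
  · rw [eval_alternatingWedge]
    refine mul_eq_zero_of_right _ (Finset.sum_eq_zero fun ρ _ => Finset.sum_eq_zero fun τ _ =>
      mul_eq_zero_of_right _ (Finset.prod_eq_zero (Finset.mem_univ (Fin.last m)) ?_))
    rw [Fin.snoc_last]
    split_ifs <;> exact H _

end LinearAlgebra
-- Pigeonhole and determinants with equal rows.
section Combinatorics

/-- Two sets of indices obtained by omitting `h + 1` of `n` indices meet if `2 h + 2 < n`. -/
theorem exists_common_index {n h : ℕ} (hn : 2 * h + 3 ≤ n) (π π' : Equiv.Perm (Fin n))
    (j₀ i₀ : Fin n) :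
    ∃ j i : Fin n, j ≠ j₀ ∧ i ≠ i₀ ∧ h ≤ (j : ℕ) ∧ h ≤ (i : ℕ) ∧ π j = π' i := by
  classical
  let S : Fin n → Finset (Fin n) := fun k => (Finset.univ.filter fun i : Fin n => h ≤ (i : ℕ)).erase k
  have hS : ∀ k, n - h - 1 ≤ (S k).card := by
    intro k
    have h1 : (Finset.univ.filter fun i : Fin n => h ≤ (i : ℕ)).card = n - h := by
      have h2 := Finset.card_filter_add_card_filter_not (s := (Finset.univ : Finset (Fin n)))
        (fun i : Fin n => (i : ℕ) < h)
      have h3 : (Finset.univ.filter fun i : Fin n => (i : ℕ) < h).card = h := by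
        rw [Fin.card_filter_val_lt]; omega
      simp only [not_lt, h3, Finset.card_univ, Fintype.card_fin] at h2
      omega
    have := Finset.pred_card_le_card_erase (s := Finset.univ.filter fun i : Fin n => h ≤ (i : ℕ))
      (a := k)
    simp only [S]
    omega
  -- `2(n - h - 1) > n` is exactly `2h + 3 ≤ n`.
  have hlt : (Finset.univ : Finset (Fin n)).card <
      ((S j₀).image π).card + ((S i₀).image π').card := by
    rw [Finset.card_image_of_injective _ π.injective, Finset.card_image_of_injective _ π'.injective,
      Finset.card_univ, Fintype.card_fin]
    have := hS j₀
    have := hS i₀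
    omega
  obtain ⟨x, hx⟩ := Finset.inter_nonempty_of_card_lt_card_add_card
    (Finset.subset_univ _) (Finset.subset_univ _) hlt
  simp only [S, Finset.mem_inter, Finset.mem_image, Finset.mem_erase, Finset.mem_filter,
    Finset.mem_univ, true_and] at hx
  obtain ⟨⟨j, ⟨hj, hj'⟩, rfl⟩, i, ⟨hi, hi'⟩, hij⟩ := hx
  exact ⟨j, i, hj, hi, hj', hi', hij.symm⟩

/-- The Leibniz sum over permutations vanishes for a matrix with two equal rows. -/
theorem sum_sign_mul_prod_eq_zero {m : ℕ} (A : Fin m → Fin m → ℝ) (i j : Fin m) (hij : i ≠ j)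
    (h : A i = A j) :
    ∑ σ : Equiv.Perm (Fin m), ((Equiv.Perm.sign σ : ℤ) : ℝ) * ∏ k, A k (σ k) = 0 := by
  have := Matrix.det_zero_of_row_eq (M := Matrix.of A) hij h
  rw [← Matrix.det_transpose, Matrix.det_apply'] at this
  exact this

end Combinatorics

/-! ### Derivatives along vector fields. -/

section Manifold

variable {E : Type*} [NormedAddCommGroup E] [NormedSpace ℝ E]
  {M : Type*} [TopologicalSpace M] [ChartedSpace E M]

/-- The derivative of `f` along the vector field `X`. -/
noncomputable def lieDeriv (X : (y : M) → TangentSpace 𝓘(ℝ, E) y) (f : M → ℝ) : M → ℝ :=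
  fun y => mvfderiv 𝓘(ℝ, E) f y (X y)

theorem mvfderiv_congr_of_eventuallyEq {f g : M → ℝ} {x : M} (h : f =ᶠ[nhds x] g) :
    mvfderiv 𝓘(ℝ, E) f x = mvfderiv 𝓘(ℝ, E) g x :=
  ContinuousLinearMap.ext fun u => DFunLike.congr_fun h.mfderiv_eq u

/-- The `if` keeps each Leibniz term a product over all slots, the form needed for determinants. -/
theorem mvfderiv_sum_mul_prod {κ : Type*} (s : Finset κ) {n : ℕ} (c : κ → ℝ)
    (g : κ → Fin n → M → ℝ) (x : M)
    (hg : ∀ t i, MDifferentiableAt 𝓘(ℝ, E) 𝓘(ℝ, ℝ) (g t i) x) (u : TangentSpace 𝓘(ℝ, E) x) :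
    mvfderiv 𝓘(ℝ, E) (fun y => ∑ t ∈ s, c t * ∏ i, g t i y) x u =
      ∑ t ∈ s, c t * ∑ j, ∏ i, if i = j then mvfderiv 𝓘(ℝ, E) (g t i) x u else g t i x := by
  have hprod : ∀ t, HasMFDerivAt 𝓘(ℝ, E) 𝓘(ℝ, ℝ) (fun y => ∏ i, g t i y) x
      (∑ j, (∏ i ∈ Finset.univ.erase j, g t i x) • mvfderiv 𝓘(ℝ, E) (g t j) x) := by
    intro t
    have := HasMFDerivAt.prod (t := Finset.univ) (f := g t) (fun i _ => (hg t i).hasMFDerivAt)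
    convert! this using 1
    ext y
    simp
  have hmul : ∀ t, MDifferentiableAt 𝓘(ℝ, E) 𝓘(ℝ, ℝ) (fun y => c t * ∏ i, g t i y) x :=
    fun t => mdifferentiableAt_const.mul (hprod t).mdifferentiableAt
  have hd : ∀ t, mvfderiv 𝓘(ℝ, E) (fun y => c t * ∏ i, g t i y) x =
      c t • ∑ j, (∏ i ∈ Finset.univ.erase j, g t i x) • mvfderiv 𝓘(ℝ, E) (g t j) x := by
    intro t
    rw [mvfderiv_fun_mul mdifferentiableAt_const (hprod t).mdifferentiableAt,
      mvfderiv_const, smul_zero, add_zero]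
    congr 1
    exact ContinuousLinearMap.ext fun u => DFunLike.congr_fun (hprod t).mfderiv u
  have h : MDifferentiableAt 𝓘(ℝ, E) 𝓘(ℝ, ℝ) (fun y => ∑ t ∈ s, c t * ∏ i, g t i y) x ∧
      mvfderiv 𝓘(ℝ, E) (fun y => ∑ t ∈ s, c t * ∏ i, g t i y) x =
      ∑ t ∈ s, c t • ∑ j, (∏ i ∈ Finset.univ.erase j, g t i x) • mvfderiv 𝓘(ℝ, E) (g t j) x := by
    classical
    induction s using Finset.induction_on with
    | empty =>
      simp only [Finset.sum_empty]
      exact ⟨mdifferentiableAt_const, mvfderiv_const _⟩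
    | insert t s ht ih =>
      simp only [Finset.sum_insert ht]
      exact ⟨(hmul t).add ih.1, by rw [mvfderiv_fun_add (hmul t) ih.1, hd, ih.2]⟩
  rw [h.2]
  simp only [sum_apply, smul_apply, smul_eq_mul]
  refine Finset.sum_congr rfl fun t _ => ?_
  congr 1
  refine Finset.sum_congr rfl fun j _ => ?_
  rw [← Finset.mul_prod_erase _ _ (Finset.mem_univ j), if_pos rfl, mul_comm]
  congr 1
  exact Finset.prod_congr rfl fun i hi => (if_neg (Finset.ne_of_mem_erase hi)).symm

variable [IsManifold 𝓘(ℝ, E) ∞ M]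

/-- `X f` is the fibre coordinate of the tangent map of `f` composed with the section `X`. -/
theorem mdifferentiableAt_lieDeriv {X : (y : M) → TangentSpace 𝓘(ℝ, E) y} {U : Set M}
    (hX : IsSmoothVectorFieldOn X U) (hU : IsOpen U) {f : M → ℝ}
    (hf : ContMDiff 𝓘(ℝ, E) 𝓘(ℝ, ℝ) ∞ f) {x : M} (hx : x ∈ U) :
    MDifferentiableAt 𝓘(ℝ, E) 𝓘(ℝ, ℝ) (lieDeriv X f) x := by
  have h1 : ContMDiff 𝓘(ℝ, E).tangent 𝓘(ℝ, ℝ).tangent ∞ (tangentMap 𝓘(ℝ, E) 𝓘(ℝ, ℝ) f) :=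
    hf.contMDiff_tangentMap le_rfl
  have h2 := (contMDiff_snd_tangentBundle_modelSpace (n := ∞) ℝ 𝓘(ℝ, ℝ)).comp h1
  have h3 := (h2.comp_contMDiffOn hX).contMDiffAt (hU.mem_nhds hx)
  exact h3.mdifferentiableAt (by simp)

end Manifold
-- The Jacobi identity and the conclusions.
section Manifold

variable {E : Type*} [NormedAddCommGroup E] [NormedSpace ℝ E]
  {M : Type*} [TopologicalSpace M] [ChartedSpace E M] [IsManifold 𝓘(ℝ, E) ∞ M]

/-- The generalized Jacobi identity at `x` for an `n`-vector field which is near `x` a sum of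
products of vector fields, any two of which share a factor other than two prescribed ones. -/
theorem sum_bracket_bracket_eq_zero {m : ℕ} (P : (x : M) → ⋀[ℝ]^(m + 1) (TangentSpace 𝓘(ℝ, E) x))
    {κ : Type*} [Fintype κ] (c : κ → ℝ) (Z : κ → Fin (m + 1) → (y : M) → TangentSpace 𝓘(ℝ, E) y)
    {U : Set M} (hU : IsOpen U) (hZ : ∀ t j, IsSmoothVectorFieldOn (Z t j) U)
    (hP : ∀ y ∈ U, ∀ f : Fin (m + 1) → M → ℝ,
      bracket P f y = ∑ t, c t * ∏ j, lieDeriv (Z t j) (f j) y)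
    (hcommon : ∀ s t j₀, ∃ (j : Fin (m + 1)) (i : Fin m), j ≠ j₀ ∧ Z t j = Z s i.succ)
    (f : Fin (2 * (m + 1) - 1) → M → ℝ) (hf : ∀ i, ContMDiff 𝓘(ℝ, E) 𝓘(ℝ, ℝ) ∞ (f i))
    {x : M} (hx : x ∈ U) :
    ∑ σ : Equiv.Perm (Fin (2 * (m + 1) - 1)), ((Equiv.Perm.sign σ : ℤ) : ℝ) *
      bracket P (fun i : Fin (m + 1) =>
        if (i : ℕ) = 0 then
          bracket P (fun j : Fin (m + 1) => f (σ ⟨j, by have := j.isLt; omega⟩))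
        else f (σ ⟨m + 1 + i - 1, by have := i.isLt; omega⟩)) x = 0 := by
  classical
  let e : Fin (m + 1) ⊕ Fin m ≃ Fin (2 * (m + 1) - 1) :=
    finSumFinEquiv.trans (finCongr (by omega))
  -- Rows: the inner fields of term `t`, with the `j₀`-th one differentiated along `Z s 0`, then the
  -- remaining outer fields of term `s`.
  let B : κ → κ → Fin (m + 1) → Fin (m + 1) ⊕ Fin m → Fin (2 * (m + 1) - 1) → ℝ :=
    fun s t j₀ => Sum.elim
      (fun j l => if j = j₀ then mvfderiv 𝓘(ℝ, E) (lieDeriv (Z t j) (f l)) x (Z s 0 x)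
        else lieDeriv (Z t j) (f l) x)
      (fun i l => lieDeriv (Z s i.succ) (f l) x)
  have hB : ∀ s t j₀, ∑ σ : Equiv.Perm (Fin (2 * (m + 1) - 1)),
      ((Equiv.Perm.sign σ : ℤ) : ℝ) * ∏ p, B s t j₀ p (σ (e p)) = 0 := by
    intro s t j₀
    obtain ⟨j, i, hj, hij⟩ := hcommon s t j₀
    rw [← sum_sign_mul_prod_eq_zero (fun k => B s t j₀ (e.symm k)) (e (Sum.inl j))
      (e (Sum.inr i)) (by simp) (by ext l; simp [B, hj, hij])]
    refine Finset.sum_congr rfl fun σ _ => ?_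
    rw [← Equiv.prod_comp e]
    simp
  have hinner : ∀ (σ : Equiv.Perm (Fin (2 * (m + 1) - 1))) (u : TangentSpace 𝓘(ℝ, E) x),
      mvfderiv 𝓘(ℝ, E) (bracket P (fun j : Fin (m + 1) =>
        f (σ ⟨j, by have := j.isLt; omega⟩))) x u =
      ∑ t, c t * ∑ j₀, ∏ j, if j = j₀ then
        mvfderiv 𝓘(ℝ, E) (lieDeriv (Z t j) (f (σ (e (Sum.inl j))))) x u
        else lieDeriv (Z t j) (f (σ (e (Sum.inl j)))) x := by
    intro σ u
    rw [← mvfderiv_sum_mul_prod Finset.univ c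
      (fun t j => lieDeriv (Z t j) (f (σ (e (Sum.inl j))))) x
      (fun t j => mdifferentiableAt_lieDeriv (hZ t j) hU (hf _) hx)]
    rw [mvfderiv_congr_of_eventuallyEq]
    filter_upwards [hU.mem_nhds hx] with y hy
    exact hP y hy _
  have hterm : ∀ σ : Equiv.Perm (Fin (2 * (m + 1) - 1)),
      bracket P (fun i : Fin (m + 1) =>
        if (i : ℕ) = 0 then
          bracket P (fun j : Fin (m + 1) => f (σ ⟨j, by have := j.isLt; omega⟩))
        else f (σ ⟨m + 1 + i - 1, by have := i.isLt; omega⟩)) x =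
      ∑ s, ∑ t, ∑ j₀, c s * c t * ∏ p, B s t j₀ p (σ (e p)) := by
    intro σ
    rw [hP x hx]
    refine Finset.sum_congr rfl fun s _ => ?_
    have hsucc : ∀ i : Fin m, (⟨m + 1 + (i.succ : Fin (m + 1)) - 1, by have := i.isLt; simp; omega⟩ :
        Fin (2 * (m + 1) - 1)) = e (Sum.inr i) := by
      intro i
      ext
      simp [e]
    rw [Fin.prod_univ_succ]
    simp only [Fin.val_zero, if_true, Fin.val_succ, Nat.succ_ne_zero, if_false]
    simp only [Fin.val_succ] at hsucc
    simp only [hsucc]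
    rw [lieDeriv, hinner]
    simp only [Fintype.prod_sum_type, B, Sum.elim_inl, Sum.elim_inr, Finset.mul_sum,
      Finset.sum_mul]
    refine Finset.sum_congr rfl fun t _ => Finset.sum_congr rfl fun j₀ _ => ?_
    ring
  simp only [hterm, Finset.mul_sum]
  rw [Finset.sum_comm]
  refine Finset.sum_eq_zero fun s _ => ?_
  rw [Finset.sum_comm]
  refine Finset.sum_eq_zero fun t _ => ?_
  rw [Finset.sum_comm]
  refine Finset.sum_eq_zero fun j₀ _ => ?_
  rw [← mul_zero (c s * c t), ← hB s t j₀, Finset.mul_sum]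
  exact Finset.sum_congr rfl fun σ _ => by ring

theorem HasSemiDecomposableForm.isPoisson {n h : ℕ} (hn : 2 * h + 3 ≤ n)
    {P : MultivectorField E M n} (hP : HasSemiDecomposableForm P h) : IsPoisson P := by
  intro f hf x
  obtain ⟨U, hU, hx, V, W, hV, hW, -, -, hPU⟩ := hP x
  obtain ⟨m, rfl⟩ : ∃ m, n = m + 1 := ⟨n - 1, by omega⟩
  refine sum_bracket_bracket_eq_zero P.toFun (κ := Equiv.Perm (Fin (m + 1)) × Equiv.Perm (Fin (m + 1)))
    (fun t => (1 / ((h.factorial : ℝ) * ((m + 1 - h).factorial : ℝ))) *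
      (((Equiv.Perm.sign t.1 : ℤ) : ℝ) * ((Equiv.Perm.sign t.2 : ℤ) : ℝ)))
    (fun t j => if (t.2 j : ℕ) < h then V (t.1 (t.2 j)) else W (t.1 (t.2 j))) hU
    (fun t j => by split_ifs; exacts [hV _, hW _]) ?_ ?_ f hf hx
  · intro y hy g
    rw [bracket, hPU y hy, eval_alternatingWedge, Fintype.sum_prod_type, Finset.mul_sum]
    refine Finset.sum_congr rfl fun ρ _ => ?_
    rw [Finset.mul_sum]
    refine Finset.sum_congr rfl fun τ _ => ?_
    rw [← mul_assoc]
    congr 1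
    refine Finset.prod_congr rfl fun j _ => ?_
    dsimp only [lieDeriv]
    split_ifs <;> rfl
  · intro s t j₀
    -- Positions `≥ h` carry `W`s; the two excluded positions are those of the second-order row.
    obtain ⟨a, b, ha, hb, hah, hbh, hab⟩ := exists_common_index hn t.1 s.1 (t.2 j₀) (s.2 0)
    obtain ⟨i, hi⟩ := Fin.exists_succ_eq.2 (fun h0 : s.2.symm b = 0 => hb (by simp [← h0]))
    refine ⟨t.2.symm a, i, fun h0 => ha (by simp [← h0]), ?_⟩
    simp [hi, hah.not_gt, hbh.not_gt, hab]

theorem HasSemiDecomposableForm.rank_eq_two_mul {n h : ℕ} (hn : h < n) (h0 : h ≠ 0)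
    {P : MultivectorField E M n} (hP : HasSemiDecomposableForm P h) (x : M) :
    rank (P.toFun x) = 2 * n := by
  obtain ⟨U, -, hx, V, W, -, -, -, hVW, hPU⟩ := hP x
  rw [hPU x hx]
  refine (rank_alternatingWedge hn (hVW h0 x hx) Sum.inl Sum.inr Sum.inr_injective
    (fun _ => Sum.inl_injective) (fun _ => by simp) ?_).trans (by simp [two_mul])
  rintro (i | i) <;> simp [h0]

theorem HasSemiDecomposableForm.rank_eq {n : ℕ} (hn : 0 < n)
    {P : MultivectorField E M n} (hP : HasSemiDecomposableForm P 0) (x : M) :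
    rank (P.toFun x) = n := by
  obtain ⟨U, -, hx, V, W, -, -, hW, -, hPU⟩ := hP x
  -- For `h = 0` the `V`s are irrelevant and may be dependent, so `W` takes their place.
  rw [hPU x hx, alternatingWedge_zero, ← alternatingWedge_zero (fun i => W i x)]
  exact (rank_alternatingWedge hn (hW x hx) id id Function.injective_id (by simp) (by simp)
    (by simp)).trans (by simp)

theorem HasSemiDecomposableForm.isDecomposable {n : ℕ}
    {P : MultivectorField E M n} (hP : HasSemiDecomposableForm P 0) : IsDecomposable P := by
  intro x
  obtain ⟨U, hU, hx, V, W, -, hW, -, -, hPU⟩ := hP x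
  exact ⟨U, hU, hx, W, hW, fun y hy => by rw [hPU y hy, alternatingWedge_zero]⟩

end Manifold
end NPoisson

theorem proposition2 {E : Type*} [NormedAddCommGroup E] [NormedSpace ℝ E] [FiniteDimensional ℝ E]
    {M : Type*} [TopologicalSpace M] [T2Space M] [ChartedSpace E M] [IsManifold 𝓘(ℝ, E) ∞ M]
    (n h : ℕ) (hn : 2 * h + 3 ≤ n) (P : NPoisson.MultivectorField E M n)
    (hP : NPoisson.HasSemiDecomposableForm P h) :
    NPoisson.IsPoisson P ∧
      (h ≠ 0 → ∀ x : M, NPoisson.rank (P.toFun x) = 2 * n) ∧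
      (h = 0 → (∀ x : M, NPoisson.rank (P.toFun x) = n) ∧ NPoisson.IsDecomposable P) := by
  refine ⟨hP.isPoisson hn, fun h0 => hP.rank_eq_two_mul (by omega) h0, ?_⟩
  rintro rfl
  exact ⟨hP.rank_eq (by omega), hP.isDecomposable⟩
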